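/- Let $T_n$ be the Chebyshev polynomial of the first kind of degree $n$. For integers $k\ge 1$ and $n\ge k+2$ let $\omega_{n,k}$ be the rightmost zero of $T_n^{(k+1)}$ and put $$\tau_{n,k}:=\frac{|T_n^{(k)}(\omega_{n,k})|}{T_n^{(k)}(1)} .$$ Let $c_1>0$ be given by $c_1^2=\frac{e^2}{2\sqrt{\pi}}$, and for $0<\lambda<1$ let $$\rho_\lambda:=\Big(\frac{2}{1+\lambda}\Big)^{1+\lambda}\Big(\frac{1-\lambda}{2}\Big)^{1-\lambda}.$$ There are absolute constants $c_2,c_3,c_4>0$ such that the following holds. (i) For all integers $k\ge1$ and $n\ge k+2$, $$\tau_{n,k}\le c_1\Big(\frac2e\Big)^k\frac{k^{1/4}}{\big(1-\frac{k^2}{n^2}\big)^{k/2}},$$ and, if in addition $n\ge k^{3/2}$, $$\tau_{n,k}<c_2\Big(\frac2e\Big)^k k^{1/4}.$$ (ii) For all integers $m\ge2$ and $n\ge m+1$, $$\tau_{n,n-m}\le c_3\,m^{1/4}\Big(\frac{me}{2}\Big)^{m/2}n^{-m/2}.$$ (iii) For every $\lambda\in(0,1)$ we have $0<\rho_\lambda<1$,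 and for all $n$ such that $k=\lfloor\lambda n\rfloor$ satisfies $1\le k\le n-2$, $$\tau_{n,k}\le c_4\,n^{1/4}\rho_\lambda^{n/2}.$$ In particular, for $\lambda=\frac12$, $\rho_{1/2}=\frac{4}{\sqrt{27}}$, the constant may be taken to be $c_1$, with strict inequality: for all $n\ge3$, $$\tau_{n,\lfloor n/2\rfloor}<c_1\,n^{1/4}\Big(\frac{4}{\sqrt{27}}\Big)^{n/2}.$$ -/

import Mathlib

/-- The `k`-th derivative of the Chebyshev polynomial of the first kind of degree `n`. -/
noncomputable def chebyshevDeriv (n k : ℕ) : Polynomial ℝ :=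
  Polynomial.derivative^[k] (Polynomial.Chebyshev.T ℝ (n : ℤ))

/-- The rightmost zero of the `(k+1)`-st derivative of `T_n` (for `k + 2 ≤ n` the set of zeros is
finite and non-empty, see `isGreatest_rightmostZero`). -/
noncomputable def rightmostZero (n k : ℕ) : ℝ :=
  sSup {x : ℝ | (chebyshevDeriv n (k + 1)).eval x = 0}

/-- All zeros of `T_n^{(k)}` are real, counted with multiplicity. -/
theorem card_roots_chebyshevDeriv (n k : ℕ) :
    n ≤ Multiset.card (chebyshevDeriv n k).roots + k := by
  induction k with
  | zero =>
    have h : Multiset.card (Polynomial.Chebyshev.T ℝ (n : ℤ)).roots = n := by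
      rw [Polynomial.Chebyshev.roots_T_real, Finset.card_val, Finset.card_image_of_injOn,
        Finset.card_range]
      exact (Finset.range n).nodup_map_iff_injOn.mp (Polynomial.Chebyshev.roots_T_real_nodup n)
    simp [chebyshevDeriv, h]
  | succ k ih =>
    have h := Polynomial.card_roots_le_derivative (chebyshevDeriv n k)
    have e : (chebyshevDeriv n k).derivative = chebyshevDeriv n (k + 1) := by
      simp only [chebyshevDeriv, Function.iterate_succ_apply']
    rw [e] at h
    omega

/-- `rightmostZero n k` is the largest zero of `T_n^{(k+1)}` whenever `k + 2 ≤ n`. -/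
theorem isGreatest_rightmostZero {n k : ℕ} (h : k + 2 ≤ n) :
    IsGreatest {x : ℝ | (chebyshevDeriv n (k + 1)).eval x = 0} (rightmostZero n k) := by
  have hc := card_roots_chebyshevDeriv n (k + 1)
  have hpos : 0 < Multiset.card (chebyshevDeriv n (k + 1)).roots := by omega
  have h0 : chebyshevDeriv n (k + 1) ≠ 0 := by
    intro h0
    simp [h0] at hpos
  obtain ⟨x, hx⟩ := Multiset.card_pos_iff_exists_mem.mp hpos
  have hs : {x : ℝ | (chebyshevDeriv n (k + 1)).eval x = 0} =
      ((chebyshevDeriv n (k + 1)).roots.toFinset : Set ℝ) := by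
    ext y
    simp [h0]
  have hf : {x : ℝ | (chebyshevDeriv n (k + 1)).eval x = 0}.Finite := by
    rw [hs]
    exact Finset.finite_toSet _
  have hne : {x : ℝ | (chebyshevDeriv n (k + 1)).eval x = 0}.Nonempty :=
    ⟨x, (Polynomial.mem_roots h0).mp hx⟩
  exact ⟨hne.csSup_mem hf, fun y hy => le_csSup hf.bddAbove hy⟩

/-- `τ_{n,k} = |T_n^{(k)}(ω_{n,k})| / T_n^{(k)}(1)`, with `ω_{n,k}` the rightmost zero of
`T_n^{(k+1)}`. -/
noncomputable def tau (n k : ℕ) : ℝ :=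
  |(chebyshevDeriv n k).eval (rightmostZero n k)| / (chebyshevDeriv n k).eval 1

/-- The constant `c₁`, the positive number with `c₁² = e² / (2 √π)`. -/
noncomputable def c₁ : ℝ := √(Real.exp 1 ^ 2 / (2 * √Real.pi))

/-- The base `ρ_t` of the exponential estimate. -/
noncomputable def rho (t : ℝ) : ℝ :=
  (2 / (1 + t)) ^ (1 + t) * ((1 - t) / 2) ^ (1 - t)

/-! Every estimate comes from one inequality, `tau_sq_le`: the square of `tau n k` is at most `e /
√(2π)` times `ρ_{k/n} ^ n`. It carries no power of `n`, `k` or `n - k`, so the fourth roots in the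
theorem are slack, used only through being at least 1.

With `x = cos θ`, the function `v = sin^k θ · T_n^{(k)}(cos θ)` satisfies `v'' + (n² - k(k-1)/sin²
θ) v = 0`. Sonin's energy `v'² + (n² - k(k-1)/sin² θ) v²` does not decrease in `θ` up to `π/2`, so
its value at `ω` is at most its value at `x = 0` (`antitoneOn_sonin`). At `ω` the derivative
`T_n^{(k+1)}` vanishes and the energy is `T_n^{(k)}(ω)²` times a weight increasing in `1 - ω²`; a
convexity argument bounds `1 - ω²` below (`one_sub_rightmostZero_sq_ge`). At the origin a two-step
recurrence and log-concavity bound the energy (`centralEnergy_sq_le`). The value at 1 is an explicit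
product, and Stirling's formula turns the quotient into a power of `ρ`.

The regimes then differ only in how `log ρ_{k/n}` is estimated: by `artanh x ≥ x` for (i), by `log u
≤ u - 1` for (ii), and by comparing `ρ_{k/n}` with `ρ_t` through a derivative for (iii). -/

/-! ### Differential equation, positivity on `[1, ∞)` and parity -/

theorem derivative_chebyshevDeriv (n k : ℕ) :
    (chebyshevDeriv n k).derivative = chebyshevDeriv n (k + 1) := by
  simp only [chebyshevDeriv, Function.iterate_succ_apply']

theorem hasDerivAt_chebyshevDeriv (n k : ℕ) (x : ℝ) :
    HasDerivAt (fun y => (chebyshevDeriv n k).eval y) ((chebyshevDeriv n (k + 1)).eval x) x := by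
  rw [← derivative_chebyshevDeriv]
  exact (chebyshevDeriv n k).hasDerivAt x

theorem chebyshevDeriv_ode (n k : ℕ) (x : ℝ) :
    (1 - x ^ 2) * (chebyshevDeriv n (k + 2)).eval x =
      (2 * k + 1) * x * (chebyshevDeriv n (k + 1)).eval x -
        ((n : ℝ) ^ 2 - (k : ℝ) ^ 2) * (chebyshevDeriv n k).eval x := by
  simpa [chebyshevDeriv] using
    Polynomial.Chebyshev.one_sub_X_sq_mul_iterate_derivative_T_eval (R := ℝ) n k x

/-- The product `∏_{j < k} (n² - j²)`. -/
noncomputable def sqDiffProd (n k : ℕ) : ℝ :=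
  ∏ j ∈ Finset.range k, ((n : ℝ) ^ 2 - (j : ℝ) ^ 2)

theorem sqDiffProd_succ (n k : ℕ) :
    sqDiffProd n (k + 1) = sqDiffProd n k * ((n : ℝ) ^ 2 - (k : ℝ) ^ 2) := by
  simp [sqDiffProd, Finset.prod_range_succ]

theorem sq_sub_sq_cast_pos {n j : ℕ} (h : j < n) : 0 < (n : ℝ) ^ 2 - (j : ℝ) ^ 2 := by
  have h1 : (j : ℝ) < n := by exact_mod_cast h
  have h2 : (0 : ℝ) ≤ j := j.cast_nonneg
  nlinarith

theorem sqDiffProd_pos {n k : ℕ} (h : k ≤ n) : 0 < sqDiffProd n k :=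
  Finset.prod_pos fun _ hj => sq_sub_sq_cast_pos ((Finset.mem_range.mp hj).trans_le h)

/-- The product `∏_{j < k} (2 j + 1) = (2 k - 1)!!`. -/
noncomputable def oddProd (k : ℕ) : ℝ := ∏ j ∈ Finset.range k, (2 * (j : ℝ) + 1)

theorem oddProd_pos (k : ℕ) : 0 < oddProd k :=
  Finset.prod_pos fun _ _ => by positivity

theorem oddProd_mul_chebyshevDeriv_one (n k : ℕ) :
    oddProd k * (chebyshevDeriv n k).eval 1 = sqDiffProd n k := by
  simpa [chebyshevDeriv, oddProd, sqDiffProd] using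
    Polynomial.Chebyshev.iterate_derivative_T_eval_one (R := ℝ) n k

theorem chebyshevDeriv_one_pos {n k : ℕ} (h : k ≤ n) : 0 < (chebyshevDeriv n k).eval 1 := by
  have := sqDiffProd_pos h
  rw [← oddProd_mul_chebyshevDeriv_one] at this
  exact pos_of_mul_pos_right this (oddProd_pos k).le

/-- Downward induction on the order, starting from the vanishing derivative of order `n + 1`: each
lower order is positive at 1 and monotone from there on. -/
theorem chebyshevDeriv_nonneg_of_one_le (n : ℕ) (d k : ℕ) (h : k + d = n + 1) {x : ℝ}
    (hx : 1 ≤ x) : 0 ≤ (chebyshevDeriv n k).eval x := by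
  induction d generalizing k x with
  | zero =>
    have : chebyshevDeriv n k = 0 := by
      refine Polynomial.iterate_derivative_eq_zero ?_
      rw [Polynomial.Chebyshev.natDegree_T]
      simp only [Int.natAbs_natCast]
      omega
    simp [this]
  | succ d ih =>
    have hm : MonotoneOn (fun y => (chebyshevDeriv n k).eval y) (Set.Ici 1) := by
      refine monotoneOn_of_deriv_nonneg (convex_Ici 1)
        (chebyshevDeriv n k).continuous.continuousOn
        (chebyshevDeriv n k).differentiable.differentiableOn fun y hy => ?_
      rw [interior_Ici] at hy
      rw [(hasDerivAt_chebyshevDeriv n k y).deriv]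
      exact ih (k + 1) (by omega) (le_of_lt hy)
    have := hm (Set.mem_Ici.mpr le_rfl) (Set.mem_Ici.mpr hx) hx
    exact (chebyshevDeriv_one_pos (by omega)).le.trans this

theorem chebyshevDeriv_pos_of_one_le {n k : ℕ} (h : k ≤ n) {x : ℝ} (hx : 1 ≤ x) :
    0 < (chebyshevDeriv n k).eval x := by
  have hm : MonotoneOn (fun y => (chebyshevDeriv n k).eval y) (Set.Ici 1) := by
    refine monotoneOn_of_deriv_nonneg (convex_Ici 1)
      (chebyshevDeriv n k).continuous.continuousOn
      (chebyshevDeriv n k).differentiable.differentiableOn fun y hy => ?_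
    rw [interior_Ici] at hy
    rw [(hasDerivAt_chebyshevDeriv n k y).deriv]
    exact chebyshevDeriv_nonneg_of_one_le n (n - k) (k + 1) (by omega) (le_of_lt hy)
  exact (chebyshevDeriv_one_pos h).trans_le
    (hm (Set.mem_Ici.mpr le_rfl) (Set.mem_Ici.mpr hx) hx)

theorem chebyshevDeriv_eval_neg (n k : ℕ) (x : ℝ) :
    (chebyshevDeriv n k).eval (-x) = (-1) ^ (n + k) * (chebyshevDeriv n k).eval x := by
  induction k generalizing x with
  | zero => simp [chebyshevDeriv, Polynomial.Chebyshev.T_eval_neg, Int.coe_negOnePow_natCast]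
  | succ k ih =>
    have h1 : HasDerivAt (fun y => (chebyshevDeriv n k).eval (-y))
        ((chebyshevDeriv n (k + 1)).eval (-x) * (-1)) x :=
      (hasDerivAt_chebyshevDeriv n k (-x)).comp x (hasDerivAt_neg x)
    have h2 : HasDerivAt (fun y => (chebyshevDeriv n k).eval (-y))
        ((-1) ^ (n + k) * (chebyshevDeriv n (k + 1)).eval x) x := by
      simp only [ih]
      exact (hasDerivAt_chebyshevDeriv n k x).const_mul _
    have := h1.unique h2
    rw [← add_assoc, pow_succ]
    linarith

/-! ### Location of the rightmost zero -/

theorem chebyshevDeriv_rightmostZero {n k : ℕ} (h : k + 2 ≤ n) :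
    (chebyshevDeriv n (k + 1)).eval (rightmostZero n k) = 0 :=
  (isGreatest_rightmostZero h).1

theorem rightmostZero_nonneg {n k : ℕ} (h : k + 2 ≤ n) : 0 ≤ rightmostZero n k := by
  have h1 : (chebyshevDeriv n (k + 1)).eval (-rightmostZero n k) = 0 := by
    rw [chebyshevDeriv_eval_neg, chebyshevDeriv_rightmostZero h, mul_zero]
  have := (isGreatest_rightmostZero h).2 h1
  linarith

theorem rightmostZero_lt_one {n k : ℕ} (h : k + 2 ≤ n) : rightmostZero n k < 1 := by
  by_contra! hc
  exact (chebyshevDeriv_pos_of_one_le (by omega : k + 1 ≤ n) hc).ne'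
    (chebyshevDeriv_rightmostZero h)

theorem chebyshevDeriv_pos_of_rightmostZero_lt {n k : ℕ} (h : k + 2 ≤ n) {x : ℝ}
    (hx : rightmostZero n k < x) : 0 < (chebyshevDeriv n (k + 1)).eval x := by
  by_contra! hc
  have h1 := chebyshevDeriv_pos_of_one_le (by omega : k + 1 ≤ n) le_rfl
  have hx1 : x ≤ 1 := by
    by_contra! hx1
    exact hc.not_gt (chebyshevDeriv_pos_of_one_le (by omega) hx1.le)
  obtain ⟨y, hy, hy0⟩ := intermediate_value_Icc hx1
    (chebyshevDeriv n (k + 1)).continuous.continuousOn ⟨hc, h1.le⟩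
  exact absurd ((isGreatest_rightmostZero h).2 hy0) (not_le.mpr (hx.trans_le hy.1))

theorem chebyshevDeriv_rightmostZero_deriv_nonneg {n k : ℕ} (h : k + 2 ≤ n) :
    0 ≤ (chebyshevDeriv n (k + 2)).eval (rightmostZero n k) := by
  have hd := (hasDerivAt_chebyshevDeriv n (k + 1) (rightmostZero n k)).hasDerivWithinAt
    (s := Set.Ioi (rightmostZero n k))
  rw [hasDerivWithinAt_iff_tendsto_slope' (by simp)] at hd
  refine ge_of_tendsto hd ?_
  filter_upwards [self_mem_nhdsWithin] with x hx
  rw [slope_def_field, chebyshevDeriv_rightmostZero h, sub_zero]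
  exact div_nonneg (chebyshevDeriv_pos_of_rightmostZero_lt h hx).le (sub_nonneg.mpr (le_of_lt hx))

/-- The rightmost zero lies in the oscillatory region of the differential equation. -/
theorem one_sub_rightmostZero_sq_ge {n k : ℕ} (hk : 1 ≤ k) (h : k + 2 ≤ n) :
    (k : ℝ) * (k + 1) / (n : ℝ) ^ 2 ≤ 1 - rightmostZero n k ^ 2 := by
  have hn : (0 : ℝ) < (n : ℝ) ^ 2 := by
    have : 0 < n := by omega
    positivity
  by_contra! hc
  rw [lt_div_iff₀ hn] at hc
  set w := rightmostZero n k with hw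
  have hw0 : 0 ≤ w := rightmostZero_nonneg h
  have hw1 : w < 1 := rightmostZero_lt_one h
  have hkr : (1 : ℝ) ≤ k := by exact_mod_cast hk
  let g : ℕ → ℝ → ℝ := fun j x => (chebyshevDeriv n j).eval x
  -- For `x = cos θ`, `W` is the `θ`-derivative of `U = sin^{k+1} θ · T_n^{(k+1)}(cos θ)`, and `U''
  -- = (k(k+1)/sin² θ - n²) U`. If the bound failed, `U` would be strictly convex and positive
  -- between `θ = 0` and the zero, hence increasing at the zero, which is impossible as it descends
  -- to 0 there.
  let W : ℝ → ℝ := fun x => (1 - x ^ 2) ^ ((k : ℝ) / 2) *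
    (((k : ℝ) + 1) * x * g (k + 1) x - (1 - x ^ 2) * g (k + 2) x)
  have hcont : ContinuousOn W (Set.Icc w 1) := by
    have h1 : Continuous W := by
      refine Continuous.mul ?_ ?_
      · exact (by fun_prop : Continuous fun x : ℝ => 1 - x ^ 2).rpow_const
          fun x => Or.inr (by positivity)
      · have := (chebyshevDeriv n (k + 1)).continuous
        have := (chebyshevDeriv n (k + 2)).continuous
        fun_prop
    exact h1.continuousOn
  have hanti : StrictAntiOn W (Set.Icc w 1) := by
    refine strictAntiOn_of_deriv_neg (convex_Icc w 1) hcont fun x hx => ?_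
    rw [interior_Icc] at hx
    have hx0 : 0 < x := hw0.trans_lt hx.1
    have hs : 0 < 1 - x ^ 2 := by nlinarith [hx.2]
    have hg : 0 < g (k + 1) x := chebyshevDeriv_pos_of_rightmostZero_lt h hx.1
    have d1 : HasDerivAt (fun y : ℝ => 1 - y ^ 2) (-(2 * x)) x := by
      simpa using (hasDerivAt_pow 2 x).const_sub 1
    have d2 := d1.rpow_const (p := (k : ℝ) / 2) (Or.inl hs.ne')
    have d3 := ((((hasDerivAt_id x).const_mul ((k : ℝ) + 1)).mul
      (hasDerivAt_chebyshevDeriv n (k + 1) x)).sub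
      (d1.mul (hasDerivAt_chebyshevDeriv n (k + 2) x)))
    have d4 : HasDerivAt W _ x := d2.mul d3
    rw [d4.deriv]
    have ode := chebyshevDeriv_ode n (k + 1) x
    have hpow : (1 - x ^ 2) ^ ((k : ℝ) / 2) =
        (1 - x ^ 2) ^ ((k : ℝ) / 2 - 1) * (1 - x ^ 2) := by
      rw [← Real.rpow_add_one hs.ne']; ring_nf
    have hneg : (1 - x ^ 2) ^ ((k : ℝ) / 2 - 1) *
        (((1 - x ^ 2) * n ^ 2 - k * (k + 1)) * g (k + 1) x) < 0 := by
      refine mul_neg_of_pos_of_neg (Real.rpow_pos_of_pos hs _) (mul_neg_of_neg_of_pos ?_ hg)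
      have : w ^ 2 < x ^ 2 := by nlinarith [hx.1]
      nlinarith
    refine lt_of_eq_of_lt ?_ hneg
    push_cast at ode
    simp only [id, g, hpow] at ode ⊢
    linear_combination -((1 - x ^ 2) ^ ((k : ℝ) / 2 - 1) * (1 - x ^ 2)) * ode
  have h1 := hanti (Set.left_mem_Icc.mpr hw1.le) (Set.right_mem_Icc.mpr hw1.le) hw1
  have hW1 : W 1 = 0 := by
    simp only [W]
    rw [one_pow, sub_self, Real.zero_rpow (by positivity), zero_mul]
  rw [hW1] at h1
  have hs : 0 < 1 - w ^ 2 := by nlinarith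
  have h2 := pos_of_mul_pos_right h1 (Real.rpow_pos_of_pos hs _).le
  have h3 : g (k + 1) w = 0 := chebyshevDeriv_rightmostZero h
  have h4 : 0 ≤ g (k + 2) w := chebyshevDeriv_rightmostZero_deriv_nonneg h
  rw [h3] at h2
  nlinarith [mul_nonneg hs.le h4]

/-! ### Values at the origin -/

theorem chebyshevDeriv_zero_recurrence (n k : ℕ) :
    (chebyshevDeriv n (k + 2)).eval 0 =
      -((n : ℝ) ^ 2 - (k : ℝ) ^ 2) * (chebyshevDeriv n k).eval 0 := by
  have := chebyshevDeriv_ode n k 0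
  linarith

theorem chebyshevDeriv_zero_of_odd {n k : ℕ} (h : Odd (n + k)) :
    (chebyshevDeriv n k).eval 0 = 0 := by
  have := chebyshevDeriv_eval_neg n k 0
  rw [h.neg_one_pow, neg_zero] at this
  linarith

theorem intCast_negOnePow_sq (m : ℤ) : (((m.negOnePow : ℤ) : ℝ)) ^ 2 = 1 := by
  rcases Int.even_or_odd m with hm | hm
  · simp [Int.negOnePow_even m hm]
  · simp [Int.negOnePow_odd m hm]

theorem chebyshevDeriv_zero_zero_sq_le (n : ℕ) : (chebyshevDeriv n 0).eval 0 ^ 2 ≤ 1 := by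
  simp only [chebyshevDeriv, Function.iterate_zero, id, Polynomial.Chebyshev.T_eval_zero]
  split_ifs
  · exact (intCast_negOnePow_sq _).le
  · simp

theorem chebyshevDeriv_one_zero_sq_le (n : ℕ) :
    (chebyshevDeriv n 1).eval 0 ^ 2 ≤ (n : ℝ) ^ 2 := by
  simp only [chebyshevDeriv, Function.iterate_one, Polynomial.Chebyshev.T_derivative_eq_U,
    Polynomial.eval_mul, Polynomial.Chebyshev.U_eval_zero, mul_pow]
  split_ifs
  · rw [intCast_negOnePow_sq]
    simp
  · simp

theorem sq_sub_sq_log_concave (N c : ℝ) (h : c ^ 2 ≤ N) (hc : 1 ≤ c) :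
    (N - (c - 1) ^ 2) * (N - (c + 1) ^ 2) ≤ (N - c ^ 2) ^ 2 := by
  nlinarith

/-- The value at 0 collects every second factor `n² - j²`. Log-concavity of these factors lets the
square of that product be compared with the full product; fourth powers avoid square roots. -/
theorem mul_chebyshevDeriv_zero_pow_four_le {n k : ℕ} (h : k ≤ n) :
    ((n : ℝ) ^ 2 - (k : ℝ) ^ 2) * ((chebyshevDeriv n k).eval 0 ^ 2) ^ 2 ≤
      (n : ℝ) ^ 2 * sqDiffProd n k ^ 2 := by
  induction k using Nat.twoStepInduction with
  | zero =>
    have h1 := chebyshevDeriv_zero_zero_sq_le n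
    have h2 : ((chebyshevDeriv n 0).eval 0 ^ 2) ^ 2 ≤ 1 := pow_le_one₀ (sq_nonneg _) h1
    have h3 := mul_le_mul_of_nonneg_left h2 (sq_nonneg (n : ℝ))
    simp only [sqDiffProd, Finset.prod_range_zero, Nat.cast_zero]
    linarith
  | one =>
    have h1 := chebyshevDeriv_one_zero_sq_le n
    have h2 : ((chebyshevDeriv n 1).eval 0 ^ 2) ^ 2 ≤ ((n : ℝ) ^ 2) ^ 2 := by gcongr
    have h3 : (0 : ℝ) ≤ (n : ℝ) ^ 2 := by positivity
    simp only [sqDiffProd, Finset.prod_range_one, Nat.cast_one, Nat.cast_zero]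
    nlinarith [sq_nonneg ((chebyshevDeriv n 1).eval 0 ^ 2)]
  | more k ih _ =>
    have ih := ih (by omega)
    have hk : k + 2 ≤ n := h
    have p0 := sq_sub_sq_cast_pos (show k < n by omega)
    have p1 : ((k : ℝ) + 1) ^ 2 ≤ (n : ℝ) ^ 2 := by
      have : ((k : ℝ) + 1) ≤ n := by exact_mod_cast (by omega : k + 1 ≤ n)
      gcongr
    have lc := sq_sub_sq_log_concave ((n : ℝ) ^ 2) (k + 1) p1 (by simp)
    have p2 : 0 ≤ (n : ℝ) ^ 2 - ((k : ℝ) + 2) ^ 2 := by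
      have : ((k : ℝ) + 2) ≤ n := by exact_mod_cast hk
      have : ((k : ℝ) + 2) ^ 2 ≤ (n : ℝ) ^ 2 := by gcongr
      linarith
    rw [chebyshevDeriv_zero_recurrence, sqDiffProd_succ, sqDiffProd_succ]
    push_cast
    rw [show (k : ℝ) + 1 - 1 = k by ring, show (k : ℝ) + 1 + 1 = k + 2 by ring] at lc
    calc _ = (((n : ℝ) ^ 2 - ((k : ℝ) + 2) ^ 2) * ((n : ℝ) ^ 2 - (k : ℝ) ^ 2) ^ 3) *
          (((n : ℝ) ^ 2 - (k : ℝ) ^ 2) * ((chebyshevDeriv n k).eval 0 ^ 2) ^ 2) := by ring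
      _ ≤ (((n : ℝ) ^ 2 - ((k : ℝ) + 2) ^ 2) * ((n : ℝ) ^ 2 - (k : ℝ) ^ 2) ^ 3) *
          ((n : ℝ) ^ 2 * sqDiffProd n k ^ 2) := by
        exact mul_le_mul_of_nonneg_left ih (by positivity)
      _ = (((n : ℝ) ^ 2 - (k : ℝ) ^ 2) * ((n : ℝ) ^ 2 - ((k : ℝ) + 2) ^ 2)) *
          (((n : ℝ) ^ 2 - (k : ℝ) ^ 2) ^ 2 * ((n : ℝ) ^ 2 * sqDiffProd n k ^ 2)) := by ring
      _ ≤ (((n : ℝ) ^ 2 - ((k : ℝ) + 1) ^ 2) ^ 2) *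
          (((n : ℝ) ^ 2 - (k : ℝ) ^ 2) ^ 2 * ((n : ℝ) ^ 2 * sqDiffProd n k ^ 2)) :=
        mul_le_mul_of_nonneg_right lc (by positivity)
      _ = _ := by ring

/-- The value at the origin of the energy `sonin n k`. -/
noncomputable def centralEnergy (n k : ℕ) : ℝ :=
  ((n : ℝ) ^ 2 - (k : ℝ) ^ 2 + k) * (chebyshevDeriv n k).eval 0 ^ 2 +
    (chebyshevDeriv n (k + 1)).eval 0 ^ 2

theorem centralEnergy_sq_le {n k : ℕ} (hk : 1 ≤ k) (h : k + 2 ≤ n) :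
    ((n : ℝ) ^ 2 - (k : ℝ) ^ 2) * centralEnergy n k ^ 2 ≤
      (n : ℝ) ^ 2 * sqDiffProd n k ^ 2 *
        ((n : ℝ) ^ 2 - (k : ℝ) ^ 2 + (n : ℝ) ^ 2 / (k + 1)) ^ 2 := by
  have p0 := sq_sub_sq_cast_pos (show k < n by omega)
  have hkr : (1 : ℝ) ≤ k := by exact_mod_cast hk
  have hn : (k : ℝ) + 2 ≤ n := by exact_mod_cast h
  have hB : (k : ℝ) ≤ (n : ℝ) ^ 2 / (k + 1) := by
    rw [le_div_iff₀ (by positivity)]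
    nlinarith
  set A : ℝ := (n : ℝ) ^ 2 - (k : ℝ) ^ 2 with hA
  set B : ℝ := (n : ℝ) ^ 2 / (k + 1) with hBdef
  rcases Nat.even_or_odd (n + k) with he | ho
  · have hz : (chebyshevDeriv n (k + 1)).eval 0 = 0 :=
      chebyshevDeriv_zero_of_odd (by rw [← add_assoc]; exact he.add_one)
    have h1 := mul_chebyshevDeriv_zero_pow_four_le (show k ≤ n by omega)
    rw [centralEnergy, hz]
    calc _ = A * ((chebyshevDeriv n k).eval 0 ^ 2) ^ 2 * (A + k) ^ 2 := by ring
      _ ≤ _ := by gcongr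
  · have hz : (chebyshevDeriv n k).eval 0 = 0 := chebyshevDeriv_zero_of_odd ho
    obtain ⟨j, rfl⟩ : ∃ j, k = j + 1 := ⟨k - 1, by omega⟩
    have h1 := mul_chebyshevDeriv_zero_pow_four_le (show j ≤ n by omega)
    have q0 := sq_sub_sq_cast_pos (show j < n by omega)
    rw [centralEnergy, hz, chebyshevDeriv_zero_recurrence, sqDiffProd_succ]
    push_cast at hA hB hBdef hkr
    set D : ℝ := (n : ℝ) ^ 2 - (j : ℝ) ^ 2 with hD
    -- Here `D = A + 2k - 1 ≤ A + 2B` for the original `k = j + 1`, and `A (A + 2B) ≤ (A + B)²`.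
    have hAD : A * D ≤ (A + B) ^ 2 := by
      have : D = A + 2 * j + 1 := by rw [hA, hD]; ring
      have hj : (0 : ℝ) ≤ j := j.cast_nonneg
      nlinarith
    calc _ = A * D ^ 3 * (D * ((chebyshevDeriv n j).eval 0 ^ 2) ^ 2) := by ring
      _ ≤ A * D ^ 3 * ((n : ℝ) ^ 2 * sqDiffProd n j ^ 2) := by gcongr
      _ = ((n : ℝ) ^ 2 * (sqDiffProd n j * D) ^ 2) * (A * D) := by ring
      _ ≤ _ := by gcongr

/-! ### Monotonicity of the energy -/

/-- The Sonin-type energy of `(1 - x²) ^ (k / 2) T_n^{(k)}`, in the variable `x`. -/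
noncomputable def sonin (n k : ℕ) (x : ℝ) : ℝ :=
  (1 - x ^ 2) ^ (k - 1) *
    (k * (chebyshevDeriv n k).eval x ^ 2 + (1 - x ^ 2) *
      (((n : ℝ) ^ 2 - (k : ℝ) ^ 2) * (chebyshevDeriv n k).eval x ^ 2 -
        2 * k * x * (chebyshevDeriv n k).eval x * (chebyshevDeriv n (k + 1)).eval x +
        (1 - x ^ 2) * (chebyshevDeriv n (k + 1)).eval x ^ 2))

theorem sonin_zero (n k : ℕ) : sonin n k 0 = centralEnergy n k := by
  simp only [sonin, centralEnergy]
  ring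

theorem antitoneOn_sonin (n k : ℕ) (hk : 1 ≤ k) : AntitoneOn (sonin n k) (Set.Icc 0 1) := by
  obtain ⟨j, rfl⟩ : ∃ j, k = j + 1 := ⟨k - 1, by omega⟩
  have hd : Differentiable ℝ (sonin n (j + 1)) := by
    have := (chebyshevDeriv n (j + 1)).differentiable
    have := (chebyshevDeriv n (j + 1 + 1)).differentiable
    unfold sonin
    fun_prop
  refine antitoneOn_of_deriv_nonpos (convex_Icc 0 1) hd.continuous.continuousOn
    hd.differentiableOn fun x hx => ?_
  rw [interior_Icc] at hx
  have hs : 0 < 1 - x ^ 2 := by nlinarith [hx.1, hx.2]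
  have d1 : HasDerivAt (fun y : ℝ => 1 - y ^ 2) (-(2 * x)) x := by
    simpa using (hasDerivAt_pow 2 x).const_sub 1
  have f0 := hasDerivAt_chebyshevDeriv n (j + 1) x
  have f1 := hasDerivAt_chebyshevDeriv n (j + 2) x
  have d2 := (d1.pow j).mul (((f0.pow 2).const_mul ((j : ℝ) + 1)).add
    (d1.mul ((((f0.pow 2).const_mul ((n : ℝ) ^ 2 - ((j : ℝ) + 1) ^ 2)).sub
      ((((hasDerivAt_id x).const_mul (2 * ((j : ℝ) + 1))).mul f0).mul f1)).add
      (d1.mul (f1.pow 2)))))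
  have d3 := d2.congr_of_eventuallyEq (f₁ := sonin n (j + 1))
    (Filter.Eventually.of_forall fun y => by simp [sonin])
  rw [d3.deriv]
  have ode := chebyshevDeriv_ode n (j + 1) x
  push_cast at ode
  -- The extra factor restores the power `j` from the power `j - 1` that differentiation produces;
  -- for `j = 0` the truncated exponent is harmless because of the coefficient `j`.
  refine nonpos_of_mul_nonpos_right (a := 1 - x ^ 2) ?_ hs
  have hneg : -(2 * ((j : ℝ) + 1) * j * x * (1 - x ^ 2) ^ j *
      (chebyshevDeriv n (j + 1)).eval x ^ 2) ≤ 0 := by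
    have := hx.1.le
    rw [neg_nonpos]
    positivity
  refine le_of_eq_of_le ?_ hneg
  have hpow : (j : ℝ) * (1 - x ^ 2) ^ (j - 1) * (1 - x ^ 2) = j * (1 - x ^ 2) ^ j := by
    rcases j with _ | j
    · simp
    · simp [pow_succ, mul_assoc]
  simp only [id, Pi.mul_apply, Pi.sub_apply, Pi.add_apply, Pi.pow_apply]
  generalize (1 - x ^ 2) ^ (j - 1) = q at *
  generalize (1 - x ^ 2) ^ j = r at *
  generalize (chebyshevDeriv n (j + 1)).eval x = a at *
  generalize (chebyshevDeriv n (j + 2)).eval x = b at *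
  generalize (chebyshevDeriv n (j + 1 + 2)).eval x = c at *
  linear_combination (1 - x ^ 2) * r * (-(2 * (j + 1) * x * a) + 2 * (1 - x ^ 2) * b) * ode -
    2 * x * ((j + 1) * a ^ 2 + (1 - x ^ 2) * (((n : ℝ) ^ 2 - ((j : ℝ) + 1) ^ 2) * a ^ 2 -
      2 * (j + 1) * x * a * b + (1 - x ^ 2) * b ^ 2)) * hpow

/-- Energy at `ω` against energy at 0, with `1 - ω²` replaced by its lower bound `s`. The term `n² /
(k + 1)` is `k / s`; this form matches the factor in `centralEnergy_sq_le`. -/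
theorem mul_chebyshevDeriv_rightmostZero_sq_le {n k : ℕ} (hk : 1 ≤ k) (h : k + 2 ≤ n) :
    ((k : ℝ) * (k + 1) / (n : ℝ) ^ 2) ^ k *
        ((n : ℝ) ^ 2 - (k : ℝ) ^ 2 + (n : ℝ) ^ 2 / (k + 1)) *
        (chebyshevDeriv n k).eval (rightmostZero n k) ^ 2 ≤ centralEnergy n k := by
  have hs := one_sub_rightmostZero_sq_ge hk h
  have h0 := rightmostZero_nonneg h
  have h1 := rightmostZero_lt_one h
  have hz := chebyshevDeriv_rightmostZero h
  have hA := sq_sub_sq_cast_pos (show k < n by omega)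
  have hn : (n : ℝ) ≠ 0 := by
    have : n ≠ 0 := by omega
    exact_mod_cast this
  have hkr : (1 : ℝ) ≤ k := by exact_mod_cast hk
  have := antitoneOn_sonin n k hk (Set.left_mem_Icc.mpr zero_le_one) ⟨h0, h1.le⟩ h0
  rw [sonin_zero] at this
  refine le_trans ?_ this
  simp only [sonin, hz]
  set w := rightmostZero n k
  set y := (chebyshevDeriv n k).eval w
  set A : ℝ := (n : ℝ) ^ 2 - (k : ℝ) ^ 2
  set s := (k : ℝ) * (k + 1) / (n : ℝ) ^ 2 with hsdef
  have hs0 : 0 ≤ s := by positivity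
  calc s ^ k * (A + (n : ℝ) ^ 2 / (k + 1)) * y ^ 2
      = s ^ (k - 1) * (k + s * A) * y ^ 2 := by
        obtain ⟨j, rfl⟩ : ∃ j, k = j + 1 := ⟨k - 1, by omega⟩
        have hj : ((j + 1 : ℕ) : ℝ) + 1 ≠ 0 := by positivity
        have : s * ((n : ℝ) ^ 2 / ((j + 1 : ℕ) + 1)) = (j + 1 : ℕ) := by
          rw [hsdef]
          field_simp
        rw [Nat.add_sub_cancel, pow_succ]
        linear_combination s ^ j * y ^ 2 * this
    _ ≤ (1 - w ^ 2) ^ (k - 1) * (k + (1 - w ^ 2) * A) * y ^ 2 := by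
        have : 0 ≤ 1 - w ^ 2 := hs0.trans hs
        gcongr
    _ = _ := by ring

/-! ### Stirling bounds for the products -/

theorem oddProd_mul_factorial (k : ℕ) :
    oddProd k * (2 ^ k * (k.factorial : ℝ)) = ((2 * k).factorial : ℝ) := by
  induction k with
  | zero => simp [oddProd]
  | succ k ih =>
    have h1 : oddProd (k + 1) = oddProd k * (2 * (k : ℝ) + 1) := by
      simp [oddProd, Finset.prod_range_succ]
    rw [h1, show 2 * (k + 1) = 2 * k + 1 + 1 by ring, Nat.factorial_succ, Nat.factorial_succ,
      Nat.factorial_succ]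
    push_cast
    rw [← ih]
    ring

/-- The index 0 must be excluded: there the defining quotient divides by zero and takes the value 0.
-/
theorem stirlingSeq_antitone {m n : ℕ} (hm : 1 ≤ m) (h : m ≤ n) :
    Stirling.stirlingSeq n ≤ Stirling.stirlingSeq m := by
  obtain ⟨a, rfl⟩ : ∃ a, m = a + 1 := ⟨m - 1, by omega⟩
  obtain ⟨b, rfl⟩ : ∃ b, n = b + 1 := ⟨n - 1, by omega⟩
  exact Stirling.stirlingSeq'_antitone (show a ≤ b by omega)

/-- The product is `(2k)! / (2^k k!)`, so comparing the Stirling sequence at `2k` and at `k`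
suffices, without its limit. -/
theorem oddProd_le {k : ℕ} (hk : 1 ≤ k) :
    oddProd k ≤ √2 * (2 * (k : ℝ) / Real.exp 1) ^ k := by
  have h := stirlingSeq_antitone hk (show k ≤ 2 * k by omega)
  have hkr : (0 : ℝ) < k := by exact_mod_cast hk
  have hf : (0 : ℝ) < (k.factorial : ℝ) := by positivity
  rw [Stirling.stirlingSeq, Stirling.stirlingSeq, ← oddProd_mul_factorial,
    div_le_div_iff₀ (by positivity) (by positivity)] at h
  push_cast at h
  have hs : √(2 * (2 * (k : ℝ))) = √2 * √(2 * (k : ℝ)) := Real.sqrt_mul (by norm_num) _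
  have he : (2 * (k : ℝ) / Real.exp 1) ^ (2 * k) =
      (2 * (k : ℝ) / Real.exp 1) ^ k * (2 ^ k * ((k : ℝ) / Real.exp 1) ^ k) := by
    rw [two_mul k, pow_add, mul_div_assoc, mul_pow]
  rw [hs, he] at h
  have hc : 0 < 2 ^ k * (k.factorial : ℝ) * (√(2 * (k : ℝ)) * ((k : ℝ) / Real.exp 1) ^ k) := by
    positivity
  refine le_of_mul_le_mul_right ?_ hc
  calc _ = oddProd k * (2 ^ k * (k.factorial : ℝ)) *
        (√(2 * (k : ℝ)) * ((k : ℝ) / Real.exp 1) ^ k) := by ring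
    _ ≤ _ := h
    _ = _ := by ring

theorem sqDiffProd_mul_factorial {n k : ℕ} (h : k ≤ n) :
    sqDiffProd n k * ((n : ℝ) + k) * ((n - k).factorial : ℝ) = n * ((n + k).factorial : ℝ) := by
  induction k with
  | zero => simp [sqDiffProd]
  | succ k ih =>
    have ih := ih (by omega)
    obtain ⟨m, rfl⟩ : ∃ m, n = k + 1 + m := ⟨n - (k + 1), by omega⟩
    rw [show k + 1 + m - k = m + 1 by omega, Nat.factorial_succ] at ih
    rw [Nat.add_sub_cancel_left, sqDiffProd_succ, ← add_assoc (k + 1 + m), Nat.factorial_succ]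
    push_cast at ih ⊢
    linear_combination ((k : ℝ) + 1 + m + k + 1) * ih

theorem factorial_le_stirling {m : ℕ} (hm : 1 ≤ m) :
    (m.factorial : ℝ) ≤ Real.exp 1 * √(m : ℝ) * ((m : ℝ) / Real.exp 1) ^ m := by
  have h := stirlingSeq_antitone le_rfl hm
  have hmr : (0 : ℝ) < m := by exact_mod_cast hm
  rw [Stirling.stirlingSeq_one, Stirling.stirlingSeq, div_le_div_iff₀ (by positivity)
    (by positivity), Real.sqrt_mul (by norm_num)] at h
  refine le_of_mul_le_mul_right (h.trans_eq ?_) (Real.sqrt_pos.mpr (two_pos : (0 : ℝ) < 2))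
  ring

theorem sqDiffProd_ge {n k : ℕ} (h : k < n) :
    (n : ℝ) * √(2 * Real.pi) * ((n : ℝ) + k) ^ (n + k) ≤
      sqDiffProd n k * √((n : ℝ) ^ 2 - (k : ℝ) ^ 2) *
        (Real.exp 1 * Real.exp 1 ^ (2 * k) * ((n : ℝ) - k) ^ (n - k)) := by
  have hP := sqDiffProd_mul_factorial h.le
  have h1 := Stirling.le_factorial_stirling (n + k)
  have h2 := factorial_le_stirling (show 1 ≤ n - k by omega)
  have hP0 := sqDiffProd_pos h.le
  have hnr : (k : ℝ) < n := by exact_mod_cast h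
  have hk0 : (0 : ℝ) ≤ k := k.cast_nonneg
  rw [Nat.cast_sub h.le] at h2
  push_cast at h1
  set a : ℝ := (n : ℝ) + k with ha
  set b : ℝ := (n : ℝ) - k with hb
  have ha0 : 0 < a := by linarith
  have hb0 : 0 < b := by linarith
  have hA : √((n : ℝ) ^ 2 - (k : ℝ) ^ 2) = √a * √b := by
    rw [← Real.sqrt_mul ha0.le]
    congr 1
    rw [ha, hb]
    ring
  have hexp : Real.exp 1 ^ (n + k) = Real.exp 1 ^ (2 * k) * Real.exp 1 ^ (n - k) := by
    rw [← pow_add]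
    congr 1
    omega
  have key : (n : ℝ) * (√(2 * Real.pi * a) * (a / Real.exp 1) ^ (n + k)) ≤
      sqDiffProd n k * a * (Real.exp 1 * √b * (b / Real.exp 1) ^ (n - k)) :=
    calc _ ≤ (n : ℝ) * ((n + k).factorial : ℝ) := by gcongr
      _ = _ := hP.symm
      _ ≤ _ := by gcongr
  rw [Real.sqrt_mul (by positivity), div_pow, div_pow, hexp] at key
  rw [hA]
  have hsa : √a * √a = a := Real.mul_self_sqrt ha0.le
  have hsa0 : 0 < √a := Real.sqrt_pos.mpr ha0
  have he : 0 < Real.exp 1 := Real.exp_pos 1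
  have hc : 0 < √a / (Real.exp 1 ^ (2 * k) * Real.exp 1 ^ (n - k)) := by positivity
  refine le_of_mul_le_mul_right ?_ hc
  calc _ = (n : ℝ) * (√(2 * Real.pi) * √a *
        (a ^ (n + k) / (Real.exp 1 ^ (2 * k) * Real.exp 1 ^ (n - k)))) := by ring
    _ ≤ _ := key
    _ = _ := by
      nth_rewrite 1 [← hsa]
      field_simp

/-! ### The master estimate in terms of `ρ` -/

theorem rho_pos {t : ℝ} (h0 : 0 < t) (h1 : t < 1) : 0 < rho t := by
  have : 0 < 1 - t := by linarith
  unfold rho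
  positivity

theorem log_rho {t : ℝ} (h0 : 0 < t) (h1 : t < 1) :
    Real.log (rho t) =
      2 * t * Real.log 2 - (1 + t) * Real.log (1 + t) + (1 - t) * Real.log (1 - t) := by
  have h2 : 0 < 1 - t := by linarith
  have h3 : 0 < 1 + t := by linarith
  rw [rho, Real.log_mul (by positivity) (by positivity), Real.log_rpow (by positivity),
    Real.log_rpow (by positivity), Real.log_div (by norm_num) h3.ne',
    Real.log_div h2.ne' (by norm_num)]
  ring

theorem rho_div_pow {n k : ℕ} (h : k < n) :
    rho ((k : ℝ) / n) ^ n * ((n : ℝ) + k) ^ (n + k) =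
      (2 * (n : ℝ)) ^ (2 * k) * ((n : ℝ) - k) ^ (n - k) := by
  have hn : (0 : ℝ) < n := by
    have : 0 < n := by omega
    exact_mod_cast this
  have hnr : (k : ℝ) < n := by exact_mod_cast h
  have hk0 : (0 : ℝ) ≤ k := k.cast_nonneg
  have e1 : 2 / (1 + (k : ℝ) / n) = 2 * n / (n + k) := by field_simp
  have e2 : (1 - (k : ℝ) / n) / 2 = (n - k) / (2 * n) := by field_simp
  have hb : 0 < (n : ℝ) - k := by linarith
  have e3 : (1 + (k : ℝ) / n) * n = ((n + k : ℕ) : ℝ) := by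
    push_cast
    field_simp
  have e4 : (1 - (k : ℝ) / n) * n = ((n - k : ℕ) : ℝ) := by
    rw [Nat.cast_sub h.le]
    field_simp
  rw [rho, e1, e2, mul_pow, ← Real.rpow_mul_natCast (by positivity),
    ← Real.rpow_mul_natCast (by positivity), e3, e4, Real.rpow_natCast, Real.rpow_natCast,
    div_pow, div_pow]
  have : (2 * (n : ℝ)) ^ (n + k) = (2 * (n : ℝ)) ^ (2 * k) * (2 * (n : ℝ)) ^ (n - k) := by
    rw [← pow_add]
    congr 1
    omega
  rw [this]
  field_simp

/-- Bernoulli gives `(1 + 1/k)^k ≥ 2`. This absorbs the 2 coming from the square of `√2` in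
`oddProd_le`. -/
theorem two_mul_pow_le {k : ℕ} (hk : 1 ≤ k) :
    2 * (k : ℝ) ^ (2 * k) ≤ ((k : ℝ) * (k + 1)) ^ k := by
  have hkr : (0 : ℝ) < k := by exact_mod_cast hk
  have h := one_add_mul_le_pow (show (-2 : ℝ) ≤ 1 / k by
    have : (0 : ℝ) < 1 / k := by positivity
    linarith) k
  rw [mul_one_div_cancel hkr.ne'] at h
  calc 2 * (k : ℝ) ^ (2 * k) ≤ (1 + 1 / (k : ℝ)) ^ k * (k : ℝ) ^ (2 * k) := by
        gcongr
        linarith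
    _ = _ := by
        rw [pow_mul, ← mul_pow]
        congr 1
        field_simp

theorem tau_sq_le {n k : ℕ} (hk : 1 ≤ k) (h : k + 2 ≤ n) :
    tau n k ^ 2 ≤ Real.exp 1 / √(2 * Real.pi) * rho ((k : ℝ) / n) ^ n := by
  have hn : (0 : ℝ) < n := by
    have : 0 < n := by omega
    exact_mod_cast this
  have hkr : (0 : ℝ) < k := by exact_mod_cast hk
  have hkn : (k : ℝ) < n := by exact_mod_cast (by omega : k < n)
  have hA := sq_sub_sq_cast_pos (show k < n by omega)
  have hP := sqDiffProd_pos (show k ≤ n by omega)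
  have hd := oddProd_pos k
  have hf := chebyshevDeriv_one_pos (show k ≤ n by omega)
  have hPd := oddProd_mul_chebyshevDeriv_one n k
  have hE := centralEnergy_sq_le hk h
  have hw := mul_chebyshevDeriv_rightmostZero_sq_le hk h
  have hst := sqDiffProd_ge (show k < n by omega)
  have hrho := rho_div_pow (show k < n by omega)
  have hodd : oddProd k ^ 2 ≤ 2 * (2 * (k : ℝ) / Real.exp 1) ^ (2 * k) := by
    calc oddProd k ^ 2 ≤ (√2 * (2 * (k : ℝ) / Real.exp 1) ^ k) ^ 2 := by
          gcongr
          exact oddProd_le hk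
      _ = _ := by rw [mul_pow, Real.sq_sqrt (by norm_num)]; ring
  have htau : tau n k ^ 2 * sqDiffProd n k ^ 2 =
      (chebyshevDeriv n k).eval (rightmostZero n k) ^ 2 * oddProd k ^ 2 := by
    rw [← hPd, tau, div_pow, sq_abs]
    field_simp
  have he : 0 < Real.exp 1 := Real.exp_pos 1
  set A : ℝ := (n : ℝ) ^ 2 - (k : ℝ) ^ 2
  set D : ℝ := A + (n : ℝ) ^ 2 / (k + 1)
  set P := sqDiffProd n k
  set d := oddProd k
  set y := (chebyshevDeriv n k).eval (rightmostZero n k)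
  set T := tau n k
  set X : ℝ := ((n : ℝ) + k) ^ (n + k)
  set Y : ℝ := ((n : ℝ) - k) ^ (n - k)
  have hX : 0 < X := by positivity
  have hY : 0 < Y := pow_pos (by linarith) _
  have hD : 0 < D := by positivity
  set s : ℝ := (k : ℝ) * (k + 1) / (n : ℝ) ^ 2 with hs
  have hs0 : 0 < s := by positivity
  have hE' : √A * centralEnergy n k ≤ n * P * D := by
    refine le_of_sq_le_sq ?_ (by positivity)
    rw [mul_pow, Real.sq_sqrt hA.le, mul_pow, mul_pow]
    exact hE
  -- The factor `D` occurs in the bounds at both ends of the energy comparison and cancels.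
  have h1 : s ^ k * y ^ 2 * √A ≤ n * P := by
    refine le_of_mul_le_mul_right ?_ hD
    calc _ = √A * (s ^ k * D * y ^ 2) := by ring
      _ ≤ √A * centralEnergy n k := by gcongr
      _ ≤ _ := hE'
  have h2 : T ^ 2 * s ^ k * (P * √A) ≤ n * d ^ 2 := by
    refine le_of_mul_le_mul_right ?_ hP
    calc _ = T ^ 2 * P ^ 2 * (s ^ k * √A) := by ring
      _ = s ^ k * y ^ 2 * √A * d ^ 2 := by rw [htau]; ring
      _ ≤ n * P * d ^ 2 := by gcongr
      _ = _ := by ring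
  have h3 : T ^ 2 * s ^ k * (n * √(2 * Real.pi) * X) ≤
      n * (2 * (2 * (k : ℝ)) ^ (2 * k)) * (Real.exp 1 * Y) := by
    calc _ ≤ T ^ 2 * s ^ k * (P * √A * (Real.exp 1 * Real.exp 1 ^ (2 * k) * Y)) := by gcongr
      _ = T ^ 2 * s ^ k * (P * √A) * (Real.exp 1 * Real.exp 1 ^ (2 * k) * Y) := by ring
      _ ≤ n * d ^ 2 * (Real.exp 1 * Real.exp 1 ^ (2 * k) * Y) :=
        mul_le_mul_of_nonneg_right h2 (by positivity)
      _ ≤ n * (2 * (2 * (k : ℝ) / Real.exp 1) ^ (2 * k)) *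
          (Real.exp 1 * Real.exp 1 ^ (2 * k) * Y) := by gcongr
      _ = _ := by
        rw [div_pow]
        field_simp
  have h4 : s ^ k * (n : ℝ) ^ (2 * k) = ((k : ℝ) * (k + 1)) ^ k := by
    rw [hs, pow_mul, ← mul_pow]
    congr 1
    field_simp
  have h5 : T ^ 2 * (√(2 * Real.pi) * X) ≤ Real.exp 1 * ((2 * (n : ℝ)) ^ (2 * k) * Y) := by
    have hc : 0 < n * s ^ k := by positivity
    refine le_of_mul_le_mul_right ?_ hc
    calc _ = T ^ 2 * s ^ k * (n * √(2 * Real.pi) * X) := by ring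
      _ ≤ _ := h3
      _ = 2 * (k : ℝ) ^ (2 * k) * (n * 2 ^ (2 * k) * (Real.exp 1 * Y)) := by
        rw [mul_pow]
        ring
      _ ≤ ((k : ℝ) * (k + 1)) ^ k * (n * 2 ^ (2 * k) * (Real.exp 1 * Y)) := by
        gcongr
        exact two_mul_pow_le hk
      _ = _ := by
        rw [← h4, mul_pow]
        ring
  rw [← hrho] at h5
  have hpi : 0 < √(2 * Real.pi) := by positivity
  rw [div_mul_eq_mul_div, le_div_iff₀ hpi]
  refine le_of_mul_le_mul_right ?_ hX
  calc _ = _ := by ring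
    _ ≤ _ := h5
    _ = _ := by ring

theorem tau_le_exp {n k : ℕ} (hk : 1 ≤ k) (h : k + 2 ≤ n) :
    tau n k ≤ √(Real.exp 1 / √(2 * Real.pi)) *
      Real.exp ((n : ℝ) * Real.log (rho ((k : ℝ) / n)) / 2) := by
  have hkr : (0 : ℝ) < k := by exact_mod_cast hk
  have hkn : (k : ℝ) < n := by exact_mod_cast (by omega : k < n)
  have hn : (0 : ℝ) < n := hkr.trans hkn
  have hr := rho_pos (div_pos hkr hn) ((div_lt_one hn).mpr hkn)
  refine (Real.le_sqrt_of_sq_le (tau_sq_le hk h)).trans_eq ?_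
  rw [Real.sqrt_mul (by positivity), Real.exp_half, Real.exp_nat_mul, Real.exp_log hr]

/-! ### Constants and estimates of `log ρ` -/

theorem c₁_pos : 0 < c₁ := by
  unfold c₁
  positivity

/-- The square of the left side is `e² / (2 √(2π))`, smaller than `c₁²` by the factor `√2`. This gap
gives the strict inequality for `λ = 1/2`. -/
theorem sqrt_mul_exp_half_lt_c₁ :
    √(Real.exp 1 / √(2 * Real.pi)) * Real.exp ((1 - Real.log 2) / 2) < c₁ := by
  rw [Real.exp_half, ← Real.sqrt_mul (by positivity), c₁]
  refine Real.sqrt_lt_sqrt (by positivity) ?_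
  have h2 : 1 < √2 := Real.lt_sqrt_of_sq_lt (by norm_num)
  have hp : 0 < √Real.pi := Real.sqrt_pos.mpr Real.pi_pos
  rw [Real.exp_sub, Real.exp_log two_pos, Real.sqrt_mul two_pos.le,
    div_mul_div_comm, ← sq]
  refine div_lt_div_of_pos_left (by positivity) (by positivity) ?_
  nlinarith

theorem sqrt_le_c₁ : √(Real.exp 1 / √(2 * Real.pi)) ≤ c₁ := by
  refine le_trans (le_mul_of_one_le_right (Real.sqrt_nonneg _) ?_) sqrt_mul_exp_half_lt_c₁.le
  refine Real.one_le_exp ?_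
  have := Real.log_two_lt_d9
  linarith

/-- This is `artanh x ≥ x`, from `log (1 + z) ≥ 2z / (z + 2)` at `z = 2x / (1 - x)`. -/
theorem two_mul_add_log_one_sub_le {x : ℝ} (h0 : 0 < x) (h1 : x < 1) :
    2 * x + Real.log (1 - x) ≤ Real.log (1 + x) := by
  have h2 : 0 < 1 - x := by linarith
  have h := Real.le_log_one_add_of_nonneg (x := 2 * x / (1 - x)) (by positivity)
  have e1 : 2 * (2 * x / (1 - x)) / (2 * x / (1 - x) + 2) = 2 * x := by
    field_simp
    ring
  have e2 : 1 + 2 * x / (1 - x) = (1 + x) / (1 - x) := by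
    field_simp
    ring
  rw [e1, e2, Real.log_div (by linarith) h2.ne'] at h
  linarith

theorem log_rho_le {x : ℝ} (h0 : 0 < x) (h1 : x < 1) :
    Real.log (rho x) ≤ 2 * x * (Real.log 2 - 1) - x * Real.log (1 - x ^ 2) := by
  have h := two_mul_add_log_one_sub_le h0 h1
  rw [log_rho h0 h1, show 1 - x ^ 2 = (1 - x) * (1 + x) by ring,
    Real.log_mul (by linarith) (by linarith)]
  linarith

/-- With `q = (1 - t)/2` and `p = 1 - q`, `ρ_t = (q^q / p^p)²`, so the claim is `q < p^{p/q}`.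
Strict Bernoulli with exponent `p/q > 1` gives `(1 - q)^{p/q} > 1 - p = q`. -/
theorem rho_lt_one {t : ℝ} (h0 : 0 < t) (h1 : t < 1) : rho t < 1 := by
  set q : ℝ := (1 - t) / 2 with hq
  have hq0 : 0 < q := by rw [hq]; linarith
  have hp0 : 0 < 1 - q := by rw [hq]; linarith
  have hr : 1 < (1 - q) / q := by
    rw [lt_div_iff₀ hq0, hq]
    linarith
  have h := one_add_mul_self_lt_rpow_one_add (s := -q) (by linarith) (by linarith) hr
  rw [mul_neg, div_mul_cancel₀ _ hq0.ne'] at h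
  have h2 : q < (1 - q) ^ ((1 - q) / q) := by
    rw [← sub_eq_add_neg, ← sub_eq_add_neg] at h
    linarith
  have h3 := Real.log_lt_log hq0 h2
  rw [Real.log_rpow hp0, div_mul_eq_mul_div, lt_div_iff₀ hq0] at h3
  have hl : Real.log (rho t) < 0 := by
    have e1 : 1 + t = 2 * (1 - q) := by rw [hq]; ring
    have e2 : 1 - t = 2 * q := by rw [hq]; ring
    have e3 : t = 1 - 2 * q := by rw [hq]; ring
    rw [log_rho h0 h1, e1, e2, Real.log_mul two_ne_zero hp0.ne',
      Real.log_mul two_ne_zero hq0.ne', e3]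
    linarith
  exact (Real.log_neg_iff (rho_pos h0 h1)).mp hl

/-- The function `log ρ_y + 2 (1 - log 2) y` has derivative `-log (1 - y²) ≥ 0`. It controls the
loss when `k/n` is rounded down from `t`. -/
theorem log_rho_sub_le {x t : ℝ} (h0 : 0 < x) (hxt : x ≤ t) (h1 : t < 1) :
    Real.log (rho x) ≤ Real.log (rho t) + 2 * (1 - Real.log 2) * (t - x) := by
  let F : ℝ → ℝ := fun y => 2 * y - (1 + y) * Real.log (1 + y) + (1 - y) * Real.log (1 - y)
  have hder : ∀ y ∈ Set.Ioo (0 : ℝ) 1, HasDerivAt F (-Real.log (1 - y ^ 2)) y := by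
    intro y hy
    have hp : 1 + y ≠ 0 := by linarith [hy.1]
    have hm : 1 - y ≠ 0 := by linarith [hy.2]
    have d1 : HasDerivAt (fun z : ℝ => 1 + z) 1 y := (hasDerivAt_id y).const_add 1
    have d2 : HasDerivAt (fun z : ℝ => 1 - z) (-1) y := (hasDerivAt_id y).const_sub 1
    have d3 := (((hasDerivAt_id y).const_mul (2 : ℝ)).sub (d1.mul (d1.log hp))).add
      (d2.mul (d2.log hm))
    refine d3.congr_deriv ?_
    rw [show 1 - y ^ 2 = (1 - y) * (1 + y) by ring, Real.log_mul hm hp]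
    field_simp
    ring
  have hmono : MonotoneOn F (Set.Ioo 0 1) := by
    refine monotoneOn_of_deriv_nonneg (convex_Ioo 0 1)
      (fun y hy => (hder y hy).continuousAt.continuousWithinAt) (fun y hy => ?_) fun y hy => ?_
    · rw [interior_Ioo] at hy
      exact (hder y hy).differentiableAt.differentiableWithinAt
    · rw [interior_Ioo] at hy
      rw [(hder y hy).deriv]
      have : Real.log (1 - y ^ 2) ≤ 0 :=
        Real.log_nonpos (by nlinarith [hy.1, hy.2]) (by nlinarith [hy.1])
      linarith
  have := hmono ⟨h0, hxt.trans_lt h1⟩ ⟨h0.trans_le hxt, h1⟩ hxt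
  simp only [F] at this
  rw [log_rho h0 (hxt.trans_lt h1), log_rho (h0.trans_le hxt) h1]
  linarith

/-! ### The three regimes -/

theorem one_le_natCast_rpow {n : ℕ} (h : 1 ≤ n) : 1 ≤ (n : ℝ) ^ (1 / 4 : ℝ) :=
  Real.one_le_rpow (by exact_mod_cast h) (by norm_num)

theorem one_sub_sq_div_sq_pos {n k : ℕ} (h : k < n) : 0 < 1 - (k : ℝ) ^ 2 / (n : ℝ) ^ 2 := by
  have hA := sq_sub_sq_cast_pos h
  have hk : (0 : ℝ) ≤ (k : ℝ) ^ 2 := by positivity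
  rw [sub_pos, div_lt_one (by linarith)]
  linarith

theorem tau_le_of_two_div_exp {n k : ℕ} (hk : 1 ≤ k) (h : k + 2 ≤ n) :
    tau n k ≤ c₁ * (2 / Real.exp 1) ^ k *
      ((k : ℝ) ^ (1 / 4 : ℝ) / (1 - (k : ℝ) ^ 2 / (n : ℝ) ^ 2) ^ ((k : ℝ) / 2)) := by
  have hkr : (0 : ℝ) < k := by exact_mod_cast hk
  have hkn : (k : ℝ) < n := by exact_mod_cast (by omega : k < n)
  have hn : (0 : ℝ) < n := hkr.trans hkn
  have hz := one_sub_sq_div_sq_pos (show k < n by omega)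
  have hl := log_rho_le (div_pos hkr hn) ((div_lt_one hn).mpr hkn)
  rw [div_pow] at hl
  have hl' := mul_le_mul_of_nonneg_left hl hn.le
  have e1 : (2 / Real.exp 1) ^ k = Real.exp (k * (Real.log 2 - 1)) := by
    rw [Real.exp_nat_mul, Real.exp_sub, Real.exp_log two_pos]
  rw [e1, Real.rpow_def_of_pos hz]
  set l := Real.log (1 - (k : ℝ) ^ 2 / (n : ℝ) ^ 2)
  have e2 : (n : ℝ) * (2 * ((k : ℝ) / n) * (Real.log 2 - 1) - (k : ℝ) / n * l) =
      2 * (k * (Real.log 2 - 1)) - k * l := by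
    field_simp
  rw [e2] at hl'
  have hc := c₁_pos
  calc tau n k ≤ _ := tau_le_exp hk h
    _ ≤ c₁ * Real.exp (k * (Real.log 2 - 1) - l * (k / 2)) := by
      gcongr
      · exact sqrt_le_c₁
      · linarith
    _ = c₁ * Real.exp (k * (Real.log 2 - 1)) * (1 / Real.exp (l * (k / 2))) := by
      rw [Real.exp_sub]
      ring
    _ ≤ _ := by
      gcongr
      exact one_le_natCast_rpow hk

theorem tau_lt_of_rpow_le {n k : ℕ} (hk : 1 ≤ k) (h : k + 2 ≤ n)
    (hkn : (k : ℝ) ^ (3 / 2 : ℝ) ≤ (n : ℝ)) :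
    tau n k < 3 * c₁ * (2 / Real.exp 1) ^ k * (k : ℝ) ^ (1 / 4 : ℝ) := by
  have hkr : (1 : ℝ) ≤ k := by exact_mod_cast hk
  have hz := one_sub_sq_div_sq_pos (show k < n by omega)
  have hA := sq_sub_sq_cast_pos (show k < n by omega)
  have hn : (k : ℝ) + 2 ≤ n := by exact_mod_cast h
  have hcube : (k : ℝ) ^ 3 ≤ (n : ℝ) ^ 2 := by
    calc (k : ℝ) ^ 3 = ((k : ℝ) ^ (3 / 2 : ℝ)) ^ 2 := by
          rw [← Real.rpow_mul_natCast (by positivity), ← Real.rpow_natCast]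
          norm_num
      _ ≤ _ := by gcongr
  -- For `k ≥ 2`, `n² - k² ≥ k³ - k² ≥ k³/2`; for `k = 1` the assumption `n ≥ 3` is needed.
  have hk3 : (k : ℝ) ^ 3 ≤ 2 * ((n : ℝ) ^ 2 - (k : ℝ) ^ 2) := by
    rcases hk.eq_or_lt with rfl | h2
    · push_cast at hn ⊢
      nlinarith
    · have h2r : (2 : ℝ) ≤ k := by exact_mod_cast h2
      nlinarith [sq_nonneg (k : ℝ)]
  have hlog := Real.one_sub_inv_le_log_of_pos hz
  have hinv : 1 - (1 - (k : ℝ) ^ 2 / (n : ℝ) ^ 2)⁻¹ =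
      -((k : ℝ) ^ 2 / ((n : ℝ) ^ 2 - (k : ℝ) ^ 2)) := by
    have hn0 : (n : ℝ) ≠ 0 := by linarith
    have e : 1 - (k : ℝ) ^ 2 / (n : ℝ) ^ 2 = ((n : ℝ) ^ 2 - (k : ℝ) ^ 2) / (n : ℝ) ^ 2 := by
      field_simp
    rw [e, inv_div]
    field_simp
    ring
  rw [hinv] at hlog
  have hbound : -1 ≤ Real.log (1 - (k : ℝ) ^ 2 / (n : ℝ) ^ 2) * (k / 2) := by
    have h1 : (k : ℝ) ^ 2 / ((n : ℝ) ^ 2 - (k : ℝ) ^ 2) * (k / 2) ≤ 1 := by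
      rw [div_mul_eq_mul_div, div_le_one hA]
      linarith
    have h2 := mul_le_mul_of_nonneg_right hlog (show (0 : ℝ) ≤ (k : ℝ) / 2 by positivity)
    linarith
  -- The power is at least `1/e > 1/3`, whence the constant `3 c₁` and the strict inequality.
  have hZ : 1 / 3 < (1 - (k : ℝ) ^ 2 / (n : ℝ) ^ 2) ^ ((k : ℝ) / 2) := by
    rw [Real.rpow_def_of_pos hz]
    refine lt_of_lt_of_le ?_ (Real.exp_le_exp.mpr hbound)
    rw [Real.exp_neg, one_div]
    exact inv_strictAnti₀ (Real.exp_pos 1) (Real.exp_one_lt_d9.trans (by norm_num))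
  have hc := c₁_pos
  have hk4 : 0 < (k : ℝ) ^ (1 / 4 : ℝ) := by positivity
  calc tau n k ≤ _ := tau_le_of_two_div_exp hk h
    _ < c₁ * (2 / Real.exp 1) ^ k * ((k : ℝ) ^ (1 / 4 : ℝ) / (1 / 3)) := by gcongr
    _ = _ := by ring

theorem tau_le_of_eq_add {n k m : ℕ} (hk : 1 ≤ k) (hm : 2 ≤ m) (h : n = k + m) :
    tau n k ≤ c₁ * (m : ℝ) ^ (1 / 4 : ℝ) *
      ((m : ℝ) * Real.exp 1 / 2) ^ ((m : ℝ) / 2) * (n : ℝ) ^ (-((m : ℝ) / 2)) := by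
  have hkr : (0 : ℝ) < k := by exact_mod_cast hk
  have hkn : (k : ℝ) < n := by exact_mod_cast (by omega : k < n)
  have hn : (0 : ℝ) < n := hkr.trans hkn
  have hmr : (0 : ℝ) < m := by exact_mod_cast (by omega : 0 < m)
  have hnm : (n : ℝ) = k + m := by exact_mod_cast h
  have hc := c₁_pos
  have hl := log_rho (div_pos hkr hn) ((div_lt_one hn).mpr hkn)
  have e1 : 1 - (k : ℝ) / n = m / n := by
    field_simp
    linarith
  -- This is `log u ≤ u - 1` at `u = 2n / (n + k)`; multiplied by `n + k`, the right side becomes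
  -- exactly `m`.
  have h1 : Real.log 2 - Real.log (1 + (k : ℝ) / n) ≤ 2 / (1 + (k : ℝ) / n) - 1 := by
    rw [← Real.log_div two_ne_zero (by positivity)]
    exact Real.log_le_sub_one_of_pos (by positivity)
  have h2 : (n : ℝ) * (1 + (k : ℝ) / n) * (2 / (1 + (k : ℝ) / n) - 1) = m := by
    field_simp
    linarith
  have h3 : (n : ℝ) * Real.log (rho ((k : ℝ) / n)) ≤
      m * (1 + Real.log m - Real.log n - Real.log 2) := by
    calc (n : ℝ) * Real.log (rho ((k : ℝ) / n))
        = n * (1 + (k : ℝ) / n) * (Real.log 2 - Real.log (1 + (k : ℝ) / n)) +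
          n * (1 - (k : ℝ) / n) * (Real.log (1 - (k : ℝ) / n) - Real.log 2) := by
          rw [hl]
          ring
      _ ≤ m + n * (1 - (k : ℝ) / n) * (Real.log (1 - (k : ℝ) / n) - Real.log 2) := by
          refine add_le_add_left ?_ _
          rw [← h2]
          gcongr
      _ = _ := by
          rw [e1, Real.log_div hmr.ne' hn.ne', mul_div_cancel₀ _ hn.ne']
          ring
  calc tau n k ≤ _ := tau_le_exp hk (by omega)
    _ ≤ c₁ * Real.exp (m * (1 + Real.log m - Real.log n - Real.log 2) / 2) := by
      gcongr
      exact sqrt_le_c₁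
    _ = c₁ * 1 * ((m : ℝ) * Real.exp 1 / 2) ^ ((m : ℝ) / 2) * (n : ℝ) ^ (-((m : ℝ) / 2)) := by
      rw [Real.rpow_def_of_pos (by positivity), Real.rpow_def_of_pos hn, mul_one, mul_assoc,
        ← Real.exp_add, Real.log_div (by positivity) two_ne_zero,
        Real.log_mul hmr.ne' (Real.exp_pos 1).ne', Real.log_exp]
      ring_nf
    _ ≤ _ := by
      gcongr
      exact one_le_natCast_rpow (by omega)

theorem tau_le_of_div_le {n k : ℕ} (hk : 1 ≤ k) (h : k + 2 ≤ n) {t : ℝ}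
    (hkt : (k : ℝ) / n ≤ t) (ht : t < 1) :
    tau n k ≤ √(Real.exp 1 / √(2 * Real.pi)) *
      Real.exp ((1 - Real.log 2) * (t * n - k)) * rho t ^ ((n : ℝ) / 2) := by
  have hkr : (0 : ℝ) < k := by exact_mod_cast hk
  have hkn : (k : ℝ) < n := by exact_mod_cast (by omega : k < n)
  have hn : (0 : ℝ) < n := hkr.trans hkn
  have hx := div_pos hkr hn
  have h1 := mul_le_mul_of_nonneg_left (log_rho_sub_le hx hkt ht) hn.le
  have e : (n : ℝ) * (Real.log (rho t) + 2 * (1 - Real.log 2) * (t - (k : ℝ) / n)) =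
      2 * ((1 - Real.log 2) * (t * n - k)) + n * Real.log (rho t) := by
    field_simp
    ring
  rw [e] at h1
  refine (tau_le_exp hk h).trans ?_
  rw [Real.rpow_def_of_pos (rho_pos (hx.trans_le hkt) ht), mul_assoc, ← Real.exp_add]
  gcongr
  linarith

/-- Rounding costs `exp ((1 - log 2)(tn - k))`, at most `e` because `0 ≤ tn - k < 1`, uniformly in
`t`. -/
theorem tau_le_of_eq_floor {t : ℝ} (h1 : t < 1) {n k : ℕ}
    (hkt : k = ⌊t * (n : ℝ)⌋₊) (hk : 1 ≤ k) (h : k + 2 ≤ n) :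
    tau n k ≤ c₁ * Real.exp 1 * (n : ℝ) ^ (1 / 4 : ℝ) * rho t ^ ((n : ℝ) / 2) := by
  have hn : (0 : ℝ) < n := by exact_mod_cast (by omega : 0 < n)
  have hkr : (0 : ℝ) < k := by exact_mod_cast hk
  have hle : (k : ℝ) ≤ t * n := by
    rw [hkt]
    refine Nat.floor_le ?_
    by_contra! hc
    rw [Nat.floor_of_nonpos hc.le] at hkt
    omega
  have hlt : t * n < k + 1 := by
    rw [hkt]
    exact Nat.lt_floor_add_one _
  have hx : (k : ℝ) / n ≤ t := (div_le_iff₀ hn).mpr hle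
  have hr := rho_pos ((div_pos hkr hn).trans_le hx) h1
  have hc := c₁_pos
  have hlog := Real.log_two_lt_d9
  have hlog0 := Real.log_pos one_lt_two
  calc tau n k ≤ _ := tau_le_of_div_le hk h hx h1
    _ ≤ c₁ * Real.exp 1 * 1 * rho t ^ ((n : ℝ) / 2) := by
      rw [mul_one]
      gcongr
      · exact sqrt_le_c₁
      · nlinarith
    _ ≤ _ := by
      gcongr
      exact one_le_natCast_rpow (by omega)

theorem rho_half : rho (1 / 2) = 4 / √27 := by
  have h1 : (0 : ℝ) ≤ 4 / 3 := by norm_num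
  refine (pow_left_inj₀ (rho_pos (by norm_num) (by norm_num)).le (by positivity)
    two_ne_zero).mp ?_
  rw [rho, div_pow, Real.sq_sqrt (by norm_num), mul_pow, ← Real.rpow_mul_natCast (by norm_num),
    ← Real.rpow_mul_natCast (by norm_num)]
  norm_num

theorem tau_lt_of_eq_half {n k : ℕ} (hkn : k = n / 2) (hk : 1 ≤ k) (h : k + 2 ≤ n) :
    tau n k < c₁ * (n : ℝ) ^ (1 / 4 : ℝ) * (4 / √27) ^ ((n : ℝ) / 2) := by
  have hn : (0 : ℝ) < n := by exact_mod_cast (by omega : 0 < n)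
  have h1 : 2 * (k : ℝ) ≤ n := by exact_mod_cast (by omega : 2 * k ≤ n)
  have h2 : (n : ℝ) ≤ 2 * k + 1 := by exact_mod_cast (by omega : n ≤ 2 * k + 1)
  have hx : (k : ℝ) / n ≤ 1 / 2 := by
    rw [div_le_iff₀ hn]
    linarith
  have hr := rho_pos (t := 1 / 2) (by norm_num) (by norm_num)
  have hc := c₁_pos
  have hlog := Real.log_two_lt_d9
  rw [← rho_half]
  calc tau n k ≤ _ := tau_le_of_div_le hk h hx (by norm_num)
    _ ≤ √(Real.exp 1 / √(2 * Real.pi)) * Real.exp ((1 - Real.log 2) / 2) *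
        rho (1 / 2) ^ ((n : ℝ) / 2) := by
      gcongr
      -- Since `n ≤ 2k + 1`, the rounding error `n/2 - k` is at most `1/2`.
      nlinarith
    _ < c₁ * 1 * rho (1 / 2) ^ ((n : ℝ) / 2) := by
      rw [mul_one]
      exact mul_lt_mul_of_pos_right sqrt_mul_exp_half_lt_c₁ (by positivity)
    _ ≤ _ := by
      gcongr
      exact one_le_natCast_rpow (by omega)

theorem theoremt1p3 :
    -- (i)
    ((∀ n k : ℕ, 1 ≤ k → k + 2 ≤ n →
        tau n k ≤ c₁ * (2 / Real.exp 1) ^ k *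
          ((k : ℝ) ^ (1 / 4 : ℝ) / (1 - (k : ℝ) ^ 2 / (n : ℝ) ^ 2) ^ ((k : ℝ) / 2))) ∧
      ∃ c₂ : ℝ, 0 < c₂ ∧ ∀ n k : ℕ, 1 ≤ k → k + 2 ≤ n → (k : ℝ) ^ (3 / 2 : ℝ) ≤ (n : ℝ) →
        tau n k < c₂ * (2 / Real.exp 1) ^ k * (k : ℝ) ^ (1 / 4 : ℝ)) ∧
    -- (ii)
    (∃ c₃ : ℝ, 0 < c₃ ∧ ∀ n k m : ℕ, 1 ≤ k → 2 ≤ m → n = k + m →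
        tau n k ≤ c₃ * (m : ℝ) ^ (1 / 4 : ℝ) *
          ((m : ℝ) * Real.exp 1 / 2) ^ ((m : ℝ) / 2) * (n : ℝ) ^ (-((m : ℝ) / 2))) ∧
    -- (iii)
    ((∀ t : ℝ, 0 < t → t < 1 → 0 < rho t ∧ rho t < 1) ∧
      (∃ c₄ : ℝ, 0 < c₄ ∧ ∀ t : ℝ, 0 < t → t < 1 →
        ∀ n k : ℕ, k = ⌊t * (n : ℝ)⌋₊ → 1 ≤ k → k + 2 ≤ n →
          tau n k ≤ c₄ * (n : ℝ) ^ (1 / 4 : ℝ) * rho t ^ ((n : ℝ) / 2)) ∧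
      ∀ n k : ℕ, k = n / 2 → 1 ≤ k → k + 2 ≤ n →
        tau n k < c₁ * (n : ℝ) ^ (1 / 4 : ℝ) * (4 / √27) ^ ((n : ℝ) / 2)) := by
  refine ⟨⟨fun n k hk h => tau_le_of_two_div_exp hk h, 3 * c₁, ?_, fun n k hk h hkn =>
    tau_lt_of_rpow_le hk h hkn⟩, ⟨c₁, c₁_pos, fun n k m hk hm h => tau_le_of_eq_add hk hm h⟩,
    fun t h0 h1 => ⟨rho_pos h0 h1, rho_lt_one h0 h1⟩,
    ⟨c₁ * Real.exp 1, ?_, fun t _ h1 n k hkt hk h => tau_le_of_eq_floor h1 hkt hk h⟩,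
    fun n k hkn hk h => tau_lt_of_eq_half hkn hk h⟩
  · have := c₁_pos
    positivity
  · exact mul_pos c₁_pos (Real.exp_pos 1)
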